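/- **Calculi.** Terms are taken modulo $\alpha$-conversion, and $\{x\backslash u\}$ is capture-free substitution. *CBN terms*: $t,u ::= x \mid t\,u \mid \lambda x.t \mid t[x\backslash u]$. *$\lambda!$-terms*: $t,u ::= x \mid t\,u \mid \lambda x.t \mid\, !t \mid \mathrm{der}(t) \mid t[x\backslash u]$. In both, $x$ is bound in the $t$ of $t[x\backslash u]$, and list contexts are $L ::= \square \mid L[x\backslash t]$. - $\to_{\mathtt n}$ is the closure under $N ::= \square \mid N\,t \mid \lambda x.N \mid N[x\backslash u]$ of the rules $L[\lambda x.t]\,u \mapsto L[t[x\backslash u]]$ (an m-step) and $t[x\backslash u] \mapsto t\{x\backslash u\}$ (an e-step). - $\to_{\mathtt f}$ is the closure under $S ::= \square \mid S\,t \mid t\,S \mid \lambda x.S \mid \mathrm{der}(S) \mid S[x\backslash u] \mid t[x\backslash S]$ of the rules $L[\lambda x.t]\,u \mapsto L[t[x\backslash u]]$ (an m-step), $t[x\backslash L[!u]] \mapsto L[t\{x\backslash u\}]$ and $\mathrm{der}(L[!t]) \mapsto L[t]$ (e-steps). $t \twoheadrightarrow^{(m,e)} u$ means that there is a reduction sequence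 from $t$ to $u$ with exactly $m$ m-steps and $e$ e-steps. CBN normal forms: $\mathsf{ne_n} ::= x \mid \mathsf{ne_n}\,t$ and $\mathsf{no_n} ::= \lambda x.\mathsf{no_n} \mid \mathsf{ne_n}$. A *clash* is a $\lambda!$-term of the form $L[!t]\,u$, $t[y\backslash L[\lambda x.u]]$, $\mathrm{der}(L[\lambda x.u])$ or $t\,(L[\lambda x.u])$. A term is *surface clash free* if it does not $\mathtt f$-reduce to a term $S[c]$ with $c$ a clash. Let $\mathsf{ne} ::= x \mid \mathsf{ne}\,\mathsf{na} \mid \mathrm{der}(\mathsf{ne}) \mid \mathsf{ne}[x\backslash\mathsf{ne}]$, $\mathsf{na} ::=\, !t \mid \mathsf{ne} \mid \mathsf{na}[x\backslash\mathsf{ne}]$, $\mathsf{nb} ::= \mathsf{ne} \mid \lambda x.\mathsf{no_{scf}} \mid \mathsf{nb}[x\backslash\mathsf{ne}]$, $\mathsf{no_{scf}} ::= \mathsf{na} \mid \mathsf{nb}$. *Sizes*: $|x|_{\mathtt n}=0$, $|\lambda x.t|_{\mathtt n}=|t\,u|_{\mathtt n}=|t|_{\mathtt n}+1$, $|t[x\backslash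 u]|_{\mathtt n}=|t|_{\mathtt n}$; $|x|_{\mathtt f}=|!t|_{\mathtt f}=0$, $|\mathrm{der}(t)|_{\mathtt f}=|t|_{\mathtt f}$, $|\lambda x.t|_{\mathtt f}=1+|t|_{\mathtt f}$, $|t\,u|_{\mathtt f}=1+|t|_{\mathtt f}+|u|_{\mathtt f}$, $|t[x\backslash u]|_{\mathtt f}=|t|_{\mathtt f}+|u|_{\mathtt f}$. **Types.** Types are $\sigma ::= \mathtt{tt} \mid M \mid M\to\sigma$, where multitypes $M=[\sigma_i]_{i\in I}$ are finite multisets of types; the tight types are $\mathtt{tt}\in\{\mathtt n,\mathtt a\}$ in system $\mathcal N$ and $\mathtt{tt}\in\{\mathtt n,\mathtt a,\mathtt{vl}\}$ in system $\mathcal B$. A context $\Gamma$ maps variables to multitypes, almost all empty; $+$ is pointwise multiset sum, and $\Gamma\setminus x$ is $\Gamma$ with $x$ sent to $[\,]$. A multitype is tight if all its elements are tight types, a context if all its values are tight, and a derivation if its final context and final type are tight. In the rules below the index $i$ ranges over a finite set. *System $\mathcal N$* (judgements $\Gamma\vdash^{(m,e,s)}t:\sigma$ on CBN terms): - $x:[\sigma]\vdash^{(0,0,0)}x:\sigma$;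 - from $\Gamma\vdash^{(m,e,s)}t:\mathtt n$ infer $\Gamma\vdash^{(m,e,s+1)}t\,u:\mathtt n$; - from $\Gamma\vdash^{(m,e,s)}t:\mathtt{tt}$ with $\Gamma(x)$ tight infer $\Gamma\setminus x\vdash^{(m,e,s+1)}\lambda x.t:\mathtt a$; - from $\Gamma\vdash^{(m,e,s)}t:\tau$ infer $\Gamma\setminus x\vdash^{(m,e,s)}\lambda x.t:\Gamma(x)\to\tau$; - from $\Gamma\vdash^{(m,e,s)}t:[\sigma_i]_i\to\tau$ and $\Delta_i\vdash^{(m_i,e_i,s_i)}u:\sigma_i$ for all $i$ infer $\Gamma+\sum_i\Delta_i\vdash^{(1+m+\sum m_i,\,1+e+\sum e_i,\,s+\sum s_i)}t\,u:\tau$; - from $\Gamma\vdash^{(m,e,s)}t:\tau$ with $\Gamma(x)=[\sigma_i]_i$ and $\Delta_i\vdash^{(m_i,e_i,s_i)}u:\sigma_i$ for all $i$ infer $(\Gamma\setminus x)+\sum_i\Delta_i\vdash^{(m+\sum m_i,\,1+e+\sum e_i,\,s+\sum s_i)}t[x\backslash u]:\tau$. *System $\mathcal B$* (on $\lambda!$-terms)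 has the same rules for variables and the same two rules for abstractions (with $\mathtt{tt}$ ranging over its own tight types), together with the following, where $\Gamma\vdash^{(m,e,s)}$ and $\Delta\vdash^{(m',e',s')}$ are the premises: - from $t:\mathtt n$ and $u:\mathtt{tt}$ with $\mathtt{tt}\neq\mathtt a$ infer $\Gamma+\Delta\vdash^{(m+m',e+e',s+s'+1)}t\,u:\mathtt n$; - $\vdash^{(0,0,0)}\,!t:\mathtt{vl}$ (rule $\mathtt{bg_p}$, with empty context); - from $t:\mathtt n$ infer $\Gamma\vdash^{(m,e,s)}\mathrm{der}(t):\mathtt n$; from $t:[\sigma]$ infer $\Gamma\vdash^{(m,e,s)}\mathrm{der}(t):\sigma$; - from $t:\tau$ and $u:\mathtt n$ with $\Gamma(x)$ tight, or from $t:\tau$ and $u:\Gamma(x)$, infer $(\Gamma\setminus x)+\Delta\vdash^{(m+m',e+e',s+s')}t[x\backslash u]:\tau$; - from $t:M\to\tau$ and $u:M$, or from $t:M\to\tau$ and $u:\mathtt n$ with $M$ tight, infer $\Gamma+\Delta\vdash^{(m+m'+1,e+e',s+s')}t\,u:\tau$; - from $\Gamma_i\vdash^{(m_i,e_i,s_i)}t:\sigma_i$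 for all $i$ infer $\sum_i\Gamma_i\vdash^{(\sum m_i,\,1+\sum e_i,\,\sum s_i)}\,!t:[\sigma_i]_i$. **Translation.** $\mathrm{cbn}(x)=x$, $\mathrm{cbn}(\lambda x.t)=\lambda x.\mathrm{cbn}(t)$, $\mathrm{cbn}(t\,u)=\mathrm{cbn}(t)\,!\mathrm{cbn}(u)$, $\mathrm{cbn}(t[x\backslash u])=\mathrm{cbn}(t)[x\backslash\,!\mathrm{cbn}(u)]$. On types and contexts, $\mathrm{cbn}$ is the inclusion of those of $\mathcal N$ into those of $\mathcal B$ (the ones without $\mathtt{vl}$). A $\mathcal B$-derivation is *CBN-relevant* if the contexts and the types of all its judgements are in the image of this inclusion, except for the type $\mathtt{vl}$ in the conclusions of rule $\mathtt{bg_p}$. **Corollary.** Let $t$ be a CBN term, $\Gamma$ an $\mathcal N$-context, $\sigma$ an $\mathcal N$-type, and $m,e,s\in\mathbb N$. 1. If there is a tight derivation of $\Gamma\vdash^{(m,e,s)}t:\sigma$ in $\mathcal N$, then there is $p\in\mathsf{no_{scf}}$, which is $\mathtt f$-normal and surface clash free, such that $\mathrm{cbn}(t)\twoheadrightarrow_{\mathtt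 f}^{(m,e)}p$ and $|p|_{\mathtt f}=s$. 2. Conversely, if there is a tight and CBN-relevant derivation of $\mathrm{cbn}(\Gamma)\vdash^{(m,e,s)}\mathrm{cbn}(t):\mathrm{cbn}(\sigma)$ in $\mathcal B$, then there is $p\in\mathsf{no_n}$ such that $t\twoheadrightarrow_{\mathtt n}^{(m,e)}p$ and $|p|_{\mathtt n}=s$. -/

import Mathlib

noncomputable section

namespace TightTyping

/-! ### Types

Types over a set `B` of base (tight) types: `σ ::= b | M | M → σ`, where multitypes `M` are finite
multisets of types.  They are built as syntax trees with lists, modulo (hereditary) permutation of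
these lists. -/

inductive PreTy (B : Type) : Type
  | base (b : B)
  | multi (M : List (PreTy B))
  | arrow (M : List (PreTy B)) (σ : PreTy B)

namespace PreTy

variable {A B : Type}

mutual
/-- Equality of types up to permutation of the lists occurring in them. -/
inductive Eqv : PreTy B → PreTy B → Prop
  | base (b : B) : Eqv (.base b) (.base b)
  | multi {M N : List (PreTy B)} : PermEqv M N → Eqv (.multi M) (.multi N)
  | arrow {M N : List (PreTy B)} {σ τ : PreTy B} :
      PermEqv M N → Eqv σ τ → Eqv (.arrow M σ) (.arrow N τ)

/-- Equality of lists of types up to permutation and `Eqv` of the elements. -/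
inductive PermEqv : List (PreTy B) → List (PreTy B) → Prop
  | nil : PermEqv [] []
  | cons {σ τ : PreTy B} {M N : List (PreTy B)} :
      Eqv σ τ → PermEqv M N → PermEqv (σ :: M) (τ :: N)
  | swap (σ τ : PreTy B) (M : List (PreTy B)) : PermEqv (σ :: τ :: M) (τ :: σ :: M)
  | trans {M N P : List (PreTy B)} : PermEqv M N → PermEqv N P → PermEqv M P
end

mutual
theorem Eqv.refl : ∀ σ : PreTy B, Eqv σ σ
  | .base b => .base b
  | .multi M => .multi (PermEqv.refl M)
  | .arrow M σ => .arrow (PermEqv.refl M) (Eqv.refl σ)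
theorem PermEqv.refl : ∀ M : List (PreTy B), PermEqv M M
  | [] => .nil
  | σ :: M => .cons (Eqv.refl σ) (PermEqv.refl M)
end

mutual
theorem Eqv.symm : ∀ {σ τ : PreTy B}, Eqv σ τ → Eqv τ σ
  | _, _, .base b => .base b
  | _, _, .multi h => .multi (PermEqv.symm h)
  | _, _, .arrow h h' => .arrow (PermEqv.symm h) (Eqv.symm h')
theorem PermEqv.symm : ∀ {M N : List (PreTy B)}, PermEqv M N → PermEqv N M
  | _, _, .nil => .nil
  | _, _, .cons h h' => .cons (Eqv.symm h) (PermEqv.symm h')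
  | _, _, .swap σ τ M => .swap τ σ M
  | _, _, .trans h h' => .trans (PermEqv.symm h') (PermEqv.symm h)
end

theorem Eqv.trans : ∀ {σ τ ρ : PreTy B}, Eqv σ τ → Eqv τ ρ → Eqv σ ρ
  | _, _, _, .base b, .base _ => .base b
  | _, _, _, .multi h, .multi k => .multi (h.trans k)
  | _, _, _, .arrow h h', .arrow k k' => .arrow (h.trans k) (Eqv.trans h' k')

theorem PermEqv.of_perm {M N : List (PreTy B)} (h : M.Perm N) : PermEqv M N := by
  induction h with
  | nil => exact .nil
  | cons x _ ih => exact .cons (.refl x) ih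
  | swap x y l => exact .swap y x l
  | trans _ _ ih ih' => exact ih.trans ih'

instance setoid (B : Type) : Setoid (PreTy B) :=
  ⟨Eqv, Eqv.refl, Eqv.symm, Eqv.trans⟩

mutual
/-- Replacement of base types. -/
def map (f : A → B) : PreTy A → PreTy B
  | .base b => .base (f b)
  | .multi M => .multi (mapList f M)
  | .arrow M σ => .arrow (mapList f M) (map f σ)
def mapList (f : A → B) : List (PreTy A) → List (PreTy B)
  | [] => []
  | σ :: M => map f σ :: mapList f M
end

mutual
theorem Eqv.map (f : A → B) : ∀ {σ τ : PreTy A}, Eqv σ τ → Eqv (σ.map f) (τ.map f)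
  | _, _, .base b => by simpa [PreTy.map] using Eqv.base (f b)
  | _, _, .multi h => by simpa [PreTy.map] using Eqv.multi (PermEqv.map f h)
  | _, _, .arrow h h' => by
      simpa [PreTy.map] using Eqv.arrow (PermEqv.map f h) (Eqv.map f h')
theorem PermEqv.map (f : A → B) :
    ∀ {M N : List (PreTy A)}, PermEqv M N → PermEqv (mapList f M) (mapList f N)
  | _, _, .nil => by simpa [PreTy.mapList] using PermEqv.nil
  | _, _, .cons h h' => by
      simpa [PreTy.mapList] using PermEqv.cons (Eqv.map f h) (PermEqv.map f h')
  | _, _, .swap σ τ M => by simpa [PreTy.mapList] using PermEqv.swap _ _ _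
  | _, _, .trans h h' => (PermEqv.map f h).trans (PermEqv.map f h')
end

theorem mapList_eq (f : A → B) (M : List (PreTy A)) : mapList f M = M.map (PreTy.map f) := by
  induction M with
  | nil => rw [mapList]; rfl
  | cons σ M ih => rw [mapList, ih]; rfl

end PreTy

/-- Types over the base types `B`. -/
def Ty (B : Type) : Type := Quotient (PreTy.setoid B)

namespace Ty

variable {A B : Type}

def mk (σ : PreTy B) : Ty B := Quotient.mk _ σ

/-- A representative of a type. -/
def out (σ : Ty B) : PreTy B := Quotient.out (s := PreTy.setoid B) σ

theorem mk_out (σ : Ty B) : mk σ.out = σ := Quotient.out_eq σ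

theorem eqv_out (σ : PreTy B) : PreTy.Eqv (mk σ).out σ :=
  Quotient.mk_out (s := PreTy.setoid B) σ

/-- A base type, seen as a type. -/
def base (b : B) : Ty B := mk (.base b)

/-- A multitype, seen as a type. -/
def multi (M : Multiset (Ty B)) : Ty B := mk (.multi (M.toList.map out))

/-- The functional type `M → σ`. -/
def arrow (M : Multiset (Ty B)) (σ : Ty B) : Ty B :=
  mk (.arrow (M.toList.map out) σ.out)

/-- Replacement of base types. -/
def map (f : A → B) : Ty A → Ty B :=
  Quotient.map (PreTy.map f) fun _ _ h => PreTy.Eqv.map f h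

/-! The next facts say that `Ty B` is freely generated by `base`, `multi` and `arrow`, and that
`map` commutes with them. -/

theorem permEqv_out (l : List (PreTy B)) :
    PreTy.PermEqv ((l.map mk : Multiset (Ty B)).toList.map out) l := by
  have h : (l.map mk : Multiset (Ty B)).toList.Perm (l.map mk) := by
    rw [← Multiset.coe_eq_coe, Multiset.coe_toList]
  refine (PreTy.PermEqv.of_perm (h.map out)).trans ?_
  clear h
  induction l with
  | nil => exact .nil
  | cons σ l ih => exact .cons (eqv_out σ) ih

theorem mk_multi (l : List (PreTy B)) : mk (.multi l) = multi (l.map mk : Multiset (Ty B)) :=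
  (Quotient.sound (PreTy.Eqv.multi (permEqv_out l))).symm

theorem mk_arrow (l : List (PreTy B)) (σ : PreTy B) :
    mk (.arrow l σ) = arrow (l.map mk : Multiset (Ty B)) (mk σ) :=
  (Quotient.sound (PreTy.Eqv.arrow (permEqv_out l) (eqv_out σ))).symm

theorem coe_eq_of_permEqv : ∀ {M N : List (PreTy B)}, PreTy.PermEqv M N →
    (M.map mk : Multiset (Ty B)) = (N.map mk : Multiset (Ty B))
  | _, _, .nil => rfl
  | _, _, .cons (σ := σ) (τ := τ) h h' => by
      have h1 : mk σ = mk τ := Quotient.sound h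
      have h2 := coe_eq_of_permEqv h'
      simp only [List.map_cons, ← Multiset.cons_coe, h1, h2]
  | _, _, .swap σ τ M => by
      simpa using List.Perm.swap _ _ _
  | _, _, .trans h h' => (coe_eq_of_permEqv h).trans (coe_eq_of_permEqv h')

theorem coe_map_out (M : Multiset (Ty B)) :
    ((M.toList.map out).map mk : Multiset (Ty B)) = M := by
  have : (mk ∘ out : Ty B → Ty B) = id := funext mk_out
  rw [List.map_map, this, List.map_id, Multiset.coe_toList]

theorem base_inj {b c : B} : base b = base c ↔ b = c := by
  refine ⟨fun h => ?_, fun h => h ▸ rfl⟩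
  cases (Quotient.exact h : PreTy.Eqv _ _); rfl

theorem multi_inj {M N : Multiset (Ty B)} : multi M = multi N ↔ M = N := by
  refine ⟨fun h => ?_, fun h => h ▸ rfl⟩
  cases (Quotient.exact h : PreTy.Eqv _ _) with
  | multi h => rw [← coe_map_out M, ← coe_map_out N, coe_eq_of_permEqv h]

theorem arrow_inj {M N : Multiset (Ty B)} {σ τ : Ty B} :
    arrow M σ = arrow N τ ↔ M = N ∧ σ = τ := by
  refine ⟨fun h => ?_, fun h => h.1 ▸ h.2 ▸ rfl⟩
  cases (Quotient.exact h : PreTy.Eqv _ _) with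
  | arrow h h' =>
    refine ⟨by rw [← coe_map_out M, ← coe_map_out N, coe_eq_of_permEqv h], ?_⟩
    rw [← mk_out σ, ← mk_out τ]
    exact Quotient.sound h'

theorem base_ne_multi {b : B} {M : Multiset (Ty B)} : base b ≠ multi M :=
  fun h => nomatch (Quotient.exact h : PreTy.Eqv _ _)

theorem base_ne_arrow {b : B} {M : Multiset (Ty B)} {σ : Ty B} : base b ≠ arrow M σ :=
  fun h => nomatch (Quotient.exact h : PreTy.Eqv _ _)

theorem multi_ne_arrow {M N : Multiset (Ty B)} {σ : Ty B} : multi M ≠ arrow N σ :=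
  fun h => nomatch (Quotient.exact h : PreTy.Eqv _ _)

theorem ind {P : Ty B → Prop} (base : ∀ b, P (base b))
    (multi : ∀ M, (∀ σ ∈ M, P σ) → P (multi M))
    (arrow : ∀ M σ, (∀ σ ∈ M, P σ) → P σ → P (arrow M σ)) (σ : Ty B) : P σ := by
  induction σ using Quotient.inductionOn with
  | h σ =>
    refine PreTy.rec (motive_1 := fun σ => P (mk σ))
      (motive_2 := fun l => ∀ σ ∈ (l.map mk : Multiset (Ty B)), P σ)
      base ?_ ?_ ?_ ?_ σ
    · intro M h; rw [mk_multi]; exact multi _ h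
    · intro M σ h h'; rw [mk_arrow]; exact arrow _ _ h h'
    · simp
    · intro σ M h h'; simpa using ⟨h, by simpa using h'⟩

theorem map_mk (f : A → B) (σ : PreTy A) : (mk σ).map f = mk (σ.map f) := rfl

theorem map_base (f : A → B) (b : A) : (base b).map f = base (f b) := by
  rw [base, map_mk, PreTy.map]; rfl

theorem coe_mapList (f : A → B) (M : Multiset (Ty A)) :
    ((PreTy.mapList f (M.toList.map out)).map mk : Multiset (Ty B)) =
      M.map (Ty.map f) := by
  conv_rhs => rw [← coe_map_out M]
  rw [PreTy.mapList_eq, Multiset.map_coe]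
  simp only [List.map_map]
  rfl

theorem map_multi (f : A → B) (M : Multiset (Ty A)) :
    (multi M).map f = multi (M.map (Ty.map f)) := by
  rw [multi, map_mk, PreTy.map, mk_multi, coe_mapList]

theorem map_arrow (f : A → B) (M : Multiset (Ty A)) (σ : Ty A) :
    (arrow M σ).map f = arrow (M.map (Ty.map f)) (σ.map f) := by
  rw [arrow, map_mk, PreTy.map, mk_arrow, coe_mapList, ← map_mk, mk_out]

/-- `σ` is a tight type, that is, a base type. -/
def Tight (σ : Ty B) : Prop := ∃ b, σ = base b

end Ty

/-- A multitype is tight if all its elements are tight types. -/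
def TightMulti {B : Type} (M : Multiset (Ty B)) : Prop := ∀ σ ∈ M, σ.Tight

/-- The multitype `[σᵢ]_{i ∈ I}`, with `I = {0, …, k - 1}`. -/
def bag {B : Type} {k : ℕ} (σ : Fin k → Ty B) : Multiset (Ty B) := Finset.univ.val.map σ

/-- Typing contexts: maps from variables (de Bruijn indices) to multitypes that are empty almost
everywhere.  The union of contexts is the pointwise sum `+`. -/
abbrev Ctx (B : Type) : Type := ℕ →₀ Multiset (Ty B)

namespace Ctx

variable {A B : Type}

/-- The context obtained when leaving the scope of a binder: the bound variable `0` is removed, and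
the variable `i + 1` is called `i` outside of the binder. -/
def tail (Γ : Ctx B) : Ctx B := Finsupp.comapDomain Nat.succ Γ Nat.succ_injective.injOn

/-- A context is tight if it assigns tight multitypes to all variables. -/
def Tight (Γ : Ctx B) : Prop := ∀ x, TightMulti (Γ x)

/-- Replacement of base types. -/
def map (f : A → B) (Γ : Ctx A) : Ctx B :=
  Γ.mapRange (Multiset.map (Ty.map f)) (Multiset.map_zero _)

end Ctx

/-! ### Counting steps -/

/-- The nature of a reduction step: multiplicative or exponential. -/
inductive StepKind : Type
  | m
  | e

/-- `CountedRed R m e t u`: there is an `R`-reduction sequence from `t` to `u` with exactly `m`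
multiplicative and `e` exponential steps. -/
inductive CountedRed {α : Type} (R : StepKind → α → α → Prop) : ℕ → ℕ → α → α → Prop
  | refl (t : α) : CountedRed R 0 0 t t
  | mStep {m e : ℕ} {t t' u : α} :
      R .m t t' → CountedRed R m e t' u → CountedRed R (m + 1) e t u
  | eStep {m e : ℕ} {t t' u : α} :
      R .e t t' → CountedRed R m e t' u → CountedRed R m (e + 1) t u

/-- The extension of a renaming under a binder. -/
def liftRen (ρ : ℕ → ℕ) : ℕ → ℕ
  | 0 => 0
  | i + 1 => ρ i + 1

/-! ### The call-by-name calculus -/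

/-- Terms with explicit substitutions modulo α-conversion, with de Bruijn indices.  In `lam t` and
in the closure `es t u`, written `t[x\u]`, the index `0` of `t` is bound. -/
inductive LTerm : Type
  | var (i : ℕ)
  | app (t u : LTerm)
  | lam (t : LTerm)
  | es (t u : LTerm)

namespace LTerm

def rename : (ℕ → ℕ) → LTerm → LTerm
  | ρ, var i => var (ρ i)
  | ρ, app t u => app (rename ρ t) (rename ρ u)
  | ρ, lam t => lam (rename (liftRen ρ) t)
  | ρ, es t u => es (rename (liftRen ρ) t) (rename ρ u)

/-- The extension of a substitution under a binder. -/
def up (f : ℕ → LTerm) : ℕ → LTerm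
  | 0 => var 0
  | i + 1 => rename Nat.succ (f i)

/-- Simultaneous capture-free substitution. -/
def subst : (ℕ → LTerm) → LTerm → LTerm
  | f, var i => f i
  | f, app t u => app (subst f t) (subst f u)
  | f, lam t => lam (subst (up f) t)
  | f, es t u => es (subst (up f) t) (subst f u)

/-- `t{x\u}`, where `x` is the variable `0` of `t`. -/
def inst (t u : LTerm) : LTerm :=
  subst (fun i => match i with
    | 0 => u
    | i + 1 => var i) t

/-- `L[t]` for the list context `L`, given as the list of the arguments of its explicit
substitutions, outermost first.  The hole is in the scope of `L.length` binders. -/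
def plug : List LTerm → LTerm → LTerm
  | [], t => t
  | u :: L, t => es (plug L t) u

/-- Call-by-name reduction: the rules `dB` (an m-step) and `sn` (an e-step), closed under the
contexts `N ::= □ | N t | λx.N | N[x\u]`. -/
inductive NStep : StepKind → LTerm → LTerm → Prop
  | dB (L : List LTerm) (t u : LTerm) :
      NStep .m (app (plug L (lam t)) u) (plug L (es t (rename (· + L.length) u)))
  | sn (t u : LTerm) : NStep .e (es t u) (inst t u)
  | app {k : StepKind} {t t' : LTerm} (u : LTerm) : NStep k t t' → NStep k (app t u) (app t' u)
  | lam {k : StepKind} {t t' : LTerm} : NStep k t t' → NStep k (lam t) (lam t')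
  | es {k : StepKind} {t t' : LTerm} (u : LTerm) : NStep k t t' → NStep k (es t u) (es t' u)

/-- `ne ::= x | ne t`. -/
inductive IsNe : LTerm → Prop
  | var (i : ℕ) : IsNe (var i)
  | app {t : LTerm} (u : LTerm) : IsNe t → IsNe (app t u)

/-- `no ::= λx.no | ne`. -/
inductive IsNo : LTerm → Prop
  | lam {t : LTerm} : IsNo t → IsNo (lam t)
  | ne {t : LTerm} : IsNe t → IsNo t

/-- The n-size. -/
def nsize : LTerm → ℕ
  | var _ => 0
  | app t _ => nsize t + 1
  | lam t => nsize t + 1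
  | es t _ => nsize t

end LTerm

/-- The base types `n` and `a` of system `N`. -/
inductive NBase : Type
  | n
  | a

/-- Derivation trees of system `N`, indexed by the judgement `Γ ⊢^(m,e,s) t : σ` they derive. -/
inductive NDer : Ctx NBase → LTerm → Ty NBase → ℕ → ℕ → ℕ → Type
  | appP {Γ : Ctx NBase} {t : LTerm} (u : LTerm) {m e s : ℕ} :
      NDer Γ t (.base .n) m e s →
      NDer Γ (.app t u) (.base .n) m e (s + 1)
  | absP {Γ : Ctx NBase} {t : LTerm} {tt : NBase} {m e s : ℕ} :
      NDer Γ t (.base tt) m e s → TightMulti (Γ 0) →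
      NDer Γ.tail (.lam t) (.base .a) m e (s + 1)
  | varC (x : ℕ) (σ : Ty NBase) :
      NDer (Finsupp.single x {σ}) (.var x) σ 0 0 0
  | absC {Γ : Ctx NBase} {t : LTerm} {τ : Ty NBase} {m e s : ℕ} :
      NDer Γ t τ m e s →
      NDer Γ.tail (.lam t) (.arrow (Γ 0) τ) m e s
  | appC {Γ : Ctx NBase} {t u : LTerm} {τ : Ty NBase} {m e s : ℕ} {k : ℕ}
      {σ : Fin k → Ty NBase} {Δ : Fin k → Ctx NBase} {m' e' s' : Fin k → ℕ} :
      NDer Γ t (.arrow (bag σ) τ) m e s →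
      (∀ i, NDer (Δ i) u (σ i) (m' i) (e' i) (s' i)) →
      NDer (Γ + ∑ i, Δ i) (.app t u) τ
        (1 + m + ∑ i, m' i) (1 + e + ∑ i, e' i) (s + ∑ i, s' i)
  | esC {Γ : Ctx NBase} {t u : LTerm} {τ : Ty NBase} {m e s : ℕ} {k : ℕ}
      {σ : Fin k → Ty NBase} {Δ : Fin k → Ctx NBase} {m' e' s' : Fin k → ℕ} :
      NDer Γ t τ m e s → Γ 0 = bag σ →
      (∀ i, NDer (Δ i) u (σ i) (m' i) (e' i) (s' i)) →
      NDer (Γ.tail + ∑ i, Δ i) (.es t u) τ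
        (m + ∑ i, m' i) (1 + e + ∑ i, e' i) (s + ∑ i, s' i)

/-- A derivation is tight if its final context and its final type are tight. -/
def NDer.Tight {Γ : Ctx NBase} {t : LTerm} {σ : Ty NBase} {m e s : ℕ}
    (_Φ : NDer Γ t σ m e s) : Prop := Γ.Tight ∧ σ.Tight

/-! ### The bang calculus at a distance -/

/-- Terms of the λ!-calculus modulo α-conversion, with de Bruijn indices.  In `lam t` and in the
closure `es t u`, written `t[x\u]`, the index `0` of `t` is bound. -/
inductive BTerm : Type
  | var (i : ℕ)
  | app (t u : BTerm)
  | lam (t : BTerm)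
  | bang (t : BTerm)
  | der (t : BTerm)
  | es (t u : BTerm)

namespace BTerm

def rename : (ℕ → ℕ) → BTerm → BTerm
  | ρ, var i => var (ρ i)
  | ρ, app t u => app (rename ρ t) (rename ρ u)
  | ρ, lam t => lam (rename (liftRen ρ) t)
  | ρ, bang t => bang (rename ρ t)
  | ρ, der t => der (rename ρ t)
  | ρ, es t u => es (rename (liftRen ρ) t) (rename ρ u)

/-- The extension of a substitution under a binder. -/
def up (f : ℕ → BTerm) : ℕ → BTerm
  | 0 => var 0
  | i + 1 => rename Nat.succ (f i)

/-- Simultaneous capture-free substitution. -/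
def subst : (ℕ → BTerm) → BTerm → BTerm
  | f, var i => f i
  | f, app t u => app (subst f t) (subst f u)
  | f, lam t => lam (subst (up f) t)
  | f, bang t => bang (subst f t)
  | f, der t => der (subst f t)
  | f, es t u => es (subst (up f) t) (subst f u)

/-- `t{x\u}`, where `x` is the variable `0` of `t`. -/
def inst (t u : BTerm) : BTerm :=
  subst (fun i => match i with
    | 0 => u
    | i + 1 => var i) t

/-- `L[t]` for the list context `L`, given as the list of the arguments of its explicit
substitutions, outermost first.  The hole is in the scope of `L.length` binders. -/
def plug : List BTerm → BTerm → BTerm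
  | [], t => t
  | u :: L, t => es (plug L t) u

/-- Surface reduction: the rules `dB` (an m-step), `s!` and `d!` (e-steps), closed under the
contexts `S ::= □ | S t | t S | λx.S | der S | S[x\u] | t[x\S]`. -/
inductive FStep : StepKind → BTerm → BTerm → Prop
  | dB (L : List BTerm) (t u : BTerm) :
      FStep .m (app (plug L (lam t)) u) (plug L (es t (rename (· + L.length) u)))
  | sBang (L : List BTerm) (t u : BTerm) :
      FStep .e (es t (plug L (bang u))) (plug L (inst (rename (liftRen (· + L.length)) t) u))
  | dBang (L : List BTerm) (t : BTerm) : FStep .e (der (plug L (bang t))) (plug L t)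
  | appL {k : StepKind} {t t' : BTerm} (u : BTerm) : FStep k t t' → FStep k (app t u) (app t' u)
  | appR {k : StepKind} (t : BTerm) {u u' : BTerm} : FStep k u u' → FStep k (app t u) (app t u')
  | lam {k : StepKind} {t t' : BTerm} : FStep k t t' → FStep k (lam t) (lam t')
  | der {k : StepKind} {t t' : BTerm} : FStep k t t' → FStep k (der t) (der t')
  | esL {k : StepKind} {t t' : BTerm} (u : BTerm) : FStep k t t' → FStep k (es t u) (es t' u)
  | esR {k : StepKind} (t : BTerm) {u u' : BTerm} : FStep k u u' → FStep k (es t u) (es t u')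

/-- `t` is f-normal. -/
def FNormal (t : BTerm) : Prop := ∀ k t', ¬ FStep k t t'

/-- Clashes. -/
inductive Clash : BTerm → Prop
  | appBang (L : List BTerm) (t u : BTerm) : Clash (app (plug L (bang t)) u)
  | esLam (L : List BTerm) (t u : BTerm) : Clash (es t (plug L (lam u)))
  | derLam (L : List BTerm) (u : BTerm) : Clash (der (plug L (lam u)))
  | appLam (L : List BTerm) (t u : BTerm) : Clash (app t (plug L (lam u)))

/-- `t = S[c]` for a surface context `S` and a clash `c`. -/
inductive HasSurfaceClash : BTerm → Prop
  | clash {c : BTerm} : Clash c → HasSurfaceClash c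
  | appL {t : BTerm} (u : BTerm) : HasSurfaceClash t → HasSurfaceClash (app t u)
  | appR (t : BTerm) {u : BTerm} : HasSurfaceClash u → HasSurfaceClash (app t u)
  | lam {t : BTerm} : HasSurfaceClash t → HasSurfaceClash (lam t)
  | der {t : BTerm} : HasSurfaceClash t → HasSurfaceClash (der t)
  | esL {t : BTerm} (u : BTerm) : HasSurfaceClash t → HasSurfaceClash (es t u)
  | esR (t : BTerm) {u : BTerm} : HasSurfaceClash u → HasSurfaceClash (es t u)

/-- `t` is surface clash free: it does not f-reduce to a term of the form `S[c]`. -/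
def SurfaceClashFree (t : BTerm) : Prop :=
  ∀ m e t', CountedRed FStep m e t t' → ¬ HasSurfaceClash t'

mutual
/-- `ne_scf ::= x | ne_scf na_scf | der ne_scf | ne_scf[x\ne_scf]`. -/
inductive IsNeScf : BTerm → Prop
  | var (i : ℕ) : IsNeScf (var i)
  | app {t u : BTerm} : IsNeScf t → IsNaScf u → IsNeScf (app t u)
  | der {t : BTerm} : IsNeScf t → IsNeScf (der t)
  | es {t u : BTerm} : IsNeScf t → IsNeScf u → IsNeScf (es t u)

/-- `na_scf ::= !t | ne_scf | na_scf[x\ne_scf]`. -/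
inductive IsNaScf : BTerm → Prop
  | bang (t : BTerm) : IsNaScf (bang t)
  | ne {t : BTerm} : IsNeScf t → IsNaScf t
  | es {t u : BTerm} : IsNaScf t → IsNeScf u → IsNaScf (es t u)

/-- `nb_scf ::= ne_scf | λx.no_scf | nb_scf[x\ne_scf]`. -/
inductive IsNbScf : BTerm → Prop
  | ne {t : BTerm} : IsNeScf t → IsNbScf t
  | lam {t : BTerm} : IsNoScf t → IsNbScf (lam t)
  | es {t u : BTerm} : IsNbScf t → IsNeScf u → IsNbScf (es t u)

/-- `no_scf ::= na_scf | nb_scf`. -/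
inductive IsNoScf : BTerm → Prop
  | na {t : BTerm} : IsNaScf t → IsNoScf t
  | nb {t : BTerm} : IsNbScf t → IsNoScf t
end

/-- The f-size. -/
def fsize : BTerm → ℕ
  | var _ => 0
  | app t u => 1 + fsize t + fsize u
  | lam t => 1 + fsize t
  | bang _ => 0
  | der t => fsize t
  | es t u => fsize t + fsize u

end BTerm

/-- The base types `n`, `a` and `vl` of system `B`. -/
inductive BBase : Type
  | n
  | a
  | vl

/-- Derivation trees of system `B`, indexed by the judgement `Γ ⊢^(m,e,s) t : σ` they derive. -/
inductive BDer : Ctx BBase → BTerm → Ty BBase → ℕ → ℕ → ℕ → Type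
  | appP {Γ Δ : Ctx BBase} {t u : BTerm} {tt : BBase} {m e s m' e' s' : ℕ} :
      BDer Γ t (.base .n) m e s → BDer Δ u (.base tt) m' e' s' → tt ≠ .a →
      BDer (Γ + Δ) (.app t u) (.base .n) (m + m') (e + e') (s + s' + 1)
  | absP {Γ : Ctx BBase} {t : BTerm} {tt : BBase} {m e s : ℕ} :
      BDer Γ t (.base tt) m e s → TightMulti (Γ 0) →
      BDer Γ.tail (.lam t) (.base .a) m e (s + 1)
  | bgP (t : BTerm) :
      BDer 0 (.bang t) (.base .vl) 0 0 0
  | drP {Γ : Ctx BBase} {t : BTerm} {m e s : ℕ} :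
      BDer Γ t (.base .n) m e s →
      BDer Γ (.der t) (.base .n) m e s
  | esP {Γ Δ : Ctx BBase} {t u : BTerm} {τ : Ty BBase} {m e s m' e' s' : ℕ} :
      BDer Γ t τ m e s → BDer Δ u (.base .n) m' e' s' → TightMulti (Γ 0) →
      BDer (Γ.tail + Δ) (.es t u) τ (m + m') (e + e') (s + s')
  | varC (x : ℕ) (σ : Ty BBase) :
      BDer (Finsupp.single x {σ}) (.var x) σ 0 0 0
  | appC {Γ Δ : Ctx BBase} {t u : BTerm} {M : Multiset (Ty BBase)} {τ : Ty BBase}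
      {m e s m' e' s' : ℕ} :
      BDer Γ t (.arrow M τ) m e s → BDer Δ u (.multi M) m' e' s' →
      BDer (Γ + Δ) (.app t u) τ (m + m' + 1) (e + e') (s + s')
  | apptC {Γ Δ : Ctx BBase} {t u : BTerm} {M : Multiset (Ty BBase)} {τ : Ty BBase}
      {m e s m' e' s' : ℕ} :
      BDer Γ t (.arrow M τ) m e s → BDer Δ u (.base .n) m' e' s' → TightMulti M →
      BDer (Γ + Δ) (.app t u) τ (m + m' + 1) (e + e') (s + s')
  | absC {Γ : Ctx BBase} {t : BTerm} {τ : Ty BBase} {m e s : ℕ} :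
      BDer Γ t τ m e s →
      BDer Γ.tail (.lam t) (.arrow (Γ 0) τ) m e s
  | bgC {k : ℕ} (t : BTerm) {Γ : Fin k → Ctx BBase} {σ : Fin k → Ty BBase}
      {m e s : Fin k → ℕ} :
      (∀ i, BDer (Γ i) t (σ i) (m i) (e i) (s i)) →
      BDer (∑ i, Γ i) (.bang t) (.multi (bag σ)) (∑ i, m i) (1 + ∑ i, e i) (∑ i, s i)
  | drC {Γ : Ctx BBase} {t : BTerm} {σ : Ty BBase} {m e s : ℕ} :
      BDer Γ t (.multi {σ}) m e s →
      BDer Γ (.der t) σ m e s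
  | esC {Γ Δ : Ctx BBase} {t u : BTerm} {σ : Ty BBase} {m e s m' e' s' : ℕ} :
      BDer Γ t σ m e s → BDer Δ u (.multi (Γ 0)) m' e' s' →
      BDer (Γ.tail + Δ) (.es t u) σ (m + m') (e + e') (s + s')

/-- A derivation is tight if its final context and its final type are tight. -/
def BDer.Tight {Γ : Ctx BBase} {t : BTerm} {σ : Ty BBase} {m e s : ℕ}
    (_Φ : BDer Γ t σ m e s) : Prop := Γ.Tight ∧ σ.Tight

/-! ### The call-by-name translation -/

/-- The embedding of call-by-name terms. -/
def cbn : LTerm → BTerm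
  | .var i => .var i
  | .app t u => .app (cbn t) (.bang (cbn u))
  | .lam t => .lam (cbn t)
  | .es t u => .es (cbn t) (.bang (cbn u))

/-- The inclusion of the base types of system `N` into those of system `B`. -/
def cbnBase : NBase → BBase
  | .n => .n
  | .a => .a

/-- The injection of the types of system `N` into those of system `B`. -/
def cbnTy : Ty NBase → Ty BBase := Ty.map cbnBase

/-- The translation of contexts. -/
def cbnCtx : Ctx NBase → Ctx BBase := Ctx.map cbnBase

/-- `Γ` and `σ` are in the image of the translation. -/
def CbnImage (Γ : Ctx BBase) (σ : Ty BBase) : Prop := Γ ∈ Set.range cbnCtx ∧ σ ∈ Set.range cbnTy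

/-- A derivation is CBN-relevant if the contexts and types of all its judgements are in the image
of the translation; the type `vl` is allowed just where the axiom `bgP` introduces it, for
arguments that are not typed in system `N`. -/
def BDer.CbnRelevant : {Γ : Ctx BBase} → {t : BTerm} → {σ : Ty BBase} → {m e s : ℕ} →
    BDer Γ t σ m e s → Prop
  | _, _, _, _, _, _, .appP (Γ := Γ) (Δ := Δ) Φ Ψ _ =>
      CbnImage (Γ + Δ) (.base .n) ∧ Φ.CbnRelevant ∧ Ψ.CbnRelevant
  | _, _, _, _, _, _, .absP (Γ := Γ) Φ _ => CbnImage Γ.tail (.base .a) ∧ Φ.CbnRelevant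
  | _, _, _, _, _, _, .bgP _ => True
  | _, _, _, _, _, _, .drP (Γ := Γ) Φ => CbnImage Γ (.base .n) ∧ Φ.CbnRelevant
  | _, _, _, _, _, _, .esP (Γ := Γ) (Δ := Δ) (τ := τ) Φ Ψ _ =>
      CbnImage (Γ.tail + Δ) τ ∧ Φ.CbnRelevant ∧ Ψ.CbnRelevant
  | _, _, _, _, _, _, .varC x σ => CbnImage (Finsupp.single x {σ}) σ
  | _, _, _, _, _, _, .appC (Γ := Γ) (Δ := Δ) (τ := τ) Φ Ψ =>
      CbnImage (Γ + Δ) τ ∧ Φ.CbnRelevant ∧ Ψ.CbnRelevant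
  | _, _, _, _, _, _, .apptC (Γ := Γ) (Δ := Δ) (τ := τ) Φ Ψ _ =>
      CbnImage (Γ + Δ) τ ∧ Φ.CbnRelevant ∧ Ψ.CbnRelevant
  | _, _, _, _, _, _, .absC (Γ := Γ) (τ := τ) Φ =>
      CbnImage Γ.tail (.arrow (Γ 0) τ) ∧ Φ.CbnRelevant
  | _, _, _, _, _, _, .bgC (Γ := Γ) (σ := σ) _ Φ =>
      CbnImage (∑ i, Γ i) (.multi (bag σ)) ∧ ∀ i, (Φ i).CbnRelevant
  | _, _, _, _, _, _, .drC (Γ := Γ) (σ := σ) Φ => CbnImage Γ σ ∧ Φ.CbnRelevant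
  | _, _, _, _, _, _, .esC (Γ := Γ) (Δ := Δ) (σ := σ) Φ Ψ =>
      CbnImage (Γ.tail + Δ) σ ∧ Φ.CbnRelevant ∧ Ψ.CbnRelevant

end TightTyping

end

open TightTyping

noncomputable section

namespace TightTyping

open Finsupp

variable {B : Type}

/-! ### Contexts -/

namespace Ctx

-- Both statements rest on one quantitative soundness theorem for the rules of system N. These rules
-- are stated in `NTyping` over an arbitrary set of base types with distinct elements `n` and `a`.
-- With `NBase` they receive N-derivations; with `BBase` they receive B-derivations of translated
-- terms, so `vl` never has to be eliminated from types. On a translated term every argument is a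
-- bang. A bang has no type `n`, so the B-rules for stuck arguments do not apply; it has type `vl`
-- when N leaves the argument untyped, and a multitype when N types it.
--
-- Types are non-idempotent: a multitype records each use of an argument, and the counters of its
-- typings are added. Substitution therefore preserves counters exactly (`NTyping.subst`). A
-- consuming application carries one m-unit and one e-unit. Its m-step pays the first and leaves the
-- second on the new closure, whose own firing pays it. So each step lowers exactly one counter by
-- one (`NTyping.nStep`).
--
-- A tightly typed normal form has counters zero except for the third, which is its size
-- (`NTyping.of_isNo`). A term that is not normal has a redex, so induction on `m + e` yields the
-- normal form (`NTyping.exists_countedRed`). The translation maps each call-by-name step to one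
-- surface step of the same kind, and normal forms to clash-free surface normal forms of equal size,
-- which transfers the result to the bang calculus.

@[simp] theorem tail_apply (Γ : Ctx B) (x : ℕ) : Γ.tail x = Γ (x + 1) := rfl

@[simp] theorem tail_add (Γ Δ : Ctx B) : tail (Γ + Δ) = tail Γ + tail Δ := by
  ext1 x; rfl

@[simp] theorem tail_single_zero (M : Multiset (Ty B)) : tail (single 0 M) = 0 := by
  ext1 x; simp

@[simp] theorem tail_mapDomain_succ (Γ : Ctx B) : tail (mapDomain Nat.succ Γ) = Γ := by
  ext1 x
  exact mapDomain_apply Nat.succ_injective Γ x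

@[simp] theorem mapDomain_succ_zero (Γ : Ctx B) : mapDomain Nat.succ Γ 0 = 0 :=
  mapDomain_of_notMem_range Γ 0 (by simp)

/-- Under a binder, a context is the part of the bound variable plus the shifted outer context. All
facts on renaming and substitution below binders reduce to this splitting. -/
theorem eq_single_add_mapDomain_tail (Γ : Ctx B) :
    Γ = single 0 (Γ 0) + mapDomain Nat.succ Γ.tail := by
  ext1 x
  cases x with
  | zero => simp
  | succ x =>
    rw [Finsupp.add_apply, single_eq_of_ne (by simp), zero_add]
    exact (mapDomain_apply Nat.succ_injective Γ.tail x).symm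

theorem mapDomain_liftRen (ρ : ℕ → ℕ) (Γ : Ctx B) :
    mapDomain (liftRen ρ) Γ = single 0 (Γ 0) + mapDomain Nat.succ (mapDomain ρ Γ.tail) := by
  conv_lhs => rw [eq_single_add_mapDomain_tail Γ]
  rw [mapDomain_add, mapDomain_single, ← mapDomain_comp, ← mapDomain_comp]
  rfl

theorem tail_mapDomain_liftRen (ρ : ℕ → ℕ) (Γ : Ctx B) :
    tail (mapDomain (liftRen ρ) Γ) = mapDomain ρ Γ.tail := by
  rw [mapDomain_liftRen]; simp

theorem mapDomain_liftRen_zero (ρ : ℕ → ℕ) (Γ : Ctx B) :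
    mapDomain (liftRen ρ) Γ 0 = Γ 0 := by
  rw [mapDomain_liftRen]; simp

theorem exists_eq_single_add {Γ : Ctx B} {x : ℕ} {σ : Ty B} (h : σ ∈ Γ x) :
    ∃ Γ', Γ = single x {σ} + Γ' := by
  obtain ⟨M, hM⟩ := Multiset.exists_cons_of_mem h
  refine ⟨Γ.update x M, ?_⟩
  ext1 y
  by_cases hy : y = x
  · subst hy; simp [hM]
  · simp [hy]

theorem Tight.of_tail {Γ : Ctx B} (h₀ : TightMulti (Γ 0)) (h : Γ.tail.Tight) : Γ.Tight
  | 0 => h₀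
  | x + 1 => h x

end Ctx

/-! ### Terms -/

namespace LTerm

theorem liftRen_comp (ρ ρ' : ℕ → ℕ) : liftRen ρ ∘ liftRen ρ' = liftRen (ρ ∘ ρ') := by
  funext x; cases x <;> rfl

theorem rename_rename (t : LTerm) : ∀ ρ ρ' : ℕ → ℕ,
    rename ρ (rename ρ' t) = rename (ρ ∘ ρ') t := by
  induction t with
  | var x => intros; rfl
  | app t u iht ihu => intros; simp only [rename, iht, ihu]
  | lam t ih => intros; simp only [rename, ih, liftRen_comp]
  | es t u iht ihu => intros; simp only [rename, iht, ihu, liftRen_comp]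

theorem liftRen_id : liftRen id = id := by
  funext x; cases x <;> rfl

theorem rename_id (t : LTerm) : rename id t = t := by
  induction t with
  | var x => rfl
  | app t u iht ihu => simp only [rename, iht, ihu]
  | lam t ih => simp only [rename, liftRen_id, ih]
  | es t u iht ihu => simp only [rename, liftRen_id, iht, ihu]

/-- Every term is a normal form or has a call-by-name redex. -/
theorem isNo_or_nStep (t : LTerm) : t.IsNo ∨ ∃ k t', NStep k t t' := by
  induction t with
  | var x => exact .inl (.ne (.var x))
  | app t u iht _ =>
    rcases iht with h | ⟨k, t', h⟩
    · cases h with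
      | lam h => exact .inr ⟨_, _, .dB [] _ u⟩
      | ne h => exact .inl (.ne (.app u h))
    · exact .inr ⟨k, _, .app u h⟩
  | lam t ih =>
    rcases ih with h | ⟨k, t', h⟩
    · exact .inl (.lam h)
    · exact .inr ⟨k, _, .lam h⟩
  | es t u _ _ => exact .inr ⟨_, _, .sn t u⟩

end LTerm

/-! ### Typability with counters

The typing rules of system `N`, over arbitrary base types with two distinguished elements `n` and
`a`, as a predicate defined by recursion on the term. -/

/-- The counters `(m, e, s)` of a judgement. -/
abbrev Cost : Type := ℕ × ℕ × ℕ

/-- `Multi P M Δ c`: each element `σᵢ` of `M` satisfies `P Δᵢ σᵢ cᵢ`, where `Δ` is the sum of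
the `Δᵢ` and `c` is the sum of the `cᵢ`. -/
inductive Multi (P : Ctx B → Ty B → Cost → Prop) : Multiset (Ty B) → Ctx B → Cost → Prop
  | zero : Multi P 0 0 0
  | cons {σ : Ty B} {M : Multiset (Ty B)} {Δ Δ' : Ctx B} {c c' : Cost} :
      P Δ σ c → Multi P M Δ' c' → Multi P (σ ::ₘ M) (Δ + Δ') (c + c')

/-- Derivability of `Γ ⊢^c t : τ` with the rules of system `N`. -/
def NTyping (n a : B) : LTerm → Ctx B → Ty B → Cost → Prop
  | .var x => fun Γ τ c => Γ = single x {τ} ∧ c = 0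
  | .app t u => fun Γ τ c =>
      (τ = .base n ∧ ∃ d, NTyping n a t Γ (.base n) d ∧ c = d + (0, 0, 1)) ∨
      ∃ Γ' Δ M d d', NTyping n a t Γ' (.arrow M τ) d ∧ Multi (NTyping n a u) M Δ d' ∧
        Γ = Γ' + Δ ∧ c = d + d' + (1, 1, 0)
  | .lam t => fun Γ τ c =>
      (τ = .base a ∧ ∃ Γ' b d, NTyping n a t Γ' (.base b) d ∧ TightMulti (Γ' 0) ∧
        Γ = Γ'.tail ∧ c = d + (0, 0, 1)) ∨
      ∃ Γ' τ', NTyping n a t Γ' τ' c ∧ Γ = Γ'.tail ∧ τ = .arrow (Γ' 0) τ'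
  | .es t u => fun Γ τ c =>
      ∃ Γ' Δ d d', NTyping n a t Γ' τ d ∧ Multi (NTyping n a u) (Γ' 0) Δ d' ∧
        Γ = Γ'.tail + Δ ∧ c = d + d' + (0, 1, 0)

theorem Multi.of_fin {P : Ctx B → Ty B → Cost → Prop} : ∀ {k : ℕ} {σ : Fin k → Ty B}
    {Δ : Fin k → Ctx B} {c : Fin k → Cost}, (∀ i, P (Δ i) (σ i) (c i)) →
    Multi P (bag σ) (∑ i, Δ i) (∑ i, c i)
  | 0, _, _, _, _ => .zero
  | k + 1, σ, Δ, c, h => by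
    have hb : bag σ = σ 0 ::ₘ bag (fun i => σ (Fin.succ i)) := by
      simp [bag, Fin.univ_succ, Function.comp_def]
    rw [hb, Fin.sum_univ_succ, Fin.sum_univ_succ]
    exact .cons (h 0) (.of_fin fun i => h i.succ)

theorem Multi.mapDomain {P Q : Ctx B → Ty B → Cost → Prop} {ρ : ℕ → ℕ}
    (h : ∀ Γ σ c, P Γ σ c → Q (Γ.mapDomain ρ) σ c) {M : Multiset (Ty B)} {Δ : Ctx B} {c : Cost}
    (H : Multi P M Δ c) : Multi Q M (Δ.mapDomain ρ) c := by
  induction H with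
  | zero => rw [mapDomain_zero]; exact .zero
  | cons hP _ ih => rw [mapDomain_add]; exact .cons (h _ _ _ hP) ih

namespace NTyping

variable {n a : B}

/-- No injectivity of `ρ` is needed: `mapDomain` adds the multitypes of variables that are
identified. -/
theorem rename {t : LTerm} : ∀ {Γ : Ctx B} {τ : Ty B} {c : Cost} (ρ : ℕ → ℕ),
    NTyping n a t Γ τ c → NTyping n a (t.rename ρ) (Γ.mapDomain ρ) τ c := by
  induction t with
  | var x =>
    rintro _ τ _ ρ ⟨rfl, rfl⟩
    exact ⟨mapDomain_single, rfl⟩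
  | app t u iht ihu =>
    rintro Γ τ _ ρ (⟨rfl, d, h, rfl⟩ | ⟨Γ', Δ, M, d, d', h, hM, rfl, rfl⟩)
    · exact .inl ⟨rfl, d, iht ρ h, rfl⟩
    · exact .inr ⟨_, _, M, d, d', iht ρ h, hM.mapDomain fun _ _ _ => ihu ρ, mapDomain_add, rfl⟩
  | lam t ih =>
    rintro _ τ c ρ (⟨rfl, Γ', b, d, h, hT, rfl, rfl⟩ | ⟨Γ', τ', h, rfl, rfl⟩)
    · exact .inl ⟨rfl, _, b, d, ih (liftRen ρ) h, by rwa [Ctx.mapDomain_liftRen_zero],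
        (Ctx.tail_mapDomain_liftRen ρ Γ').symm, rfl⟩
    · exact .inr ⟨_, τ', ih (liftRen ρ) h, (Ctx.tail_mapDomain_liftRen ρ Γ').symm,
        by rw [Ctx.mapDomain_liftRen_zero]⟩
  | es t u iht ihu =>
    rintro _ τ _ ρ ⟨Γ', Δ, d, d', h, hM, rfl, rfl⟩
    refine ⟨_, mapDomain ρ Δ, d, d', iht (liftRen ρ) h, ?_, ?_, rfl⟩
    · rw [Ctx.mapDomain_liftRen_zero]; exact hM.mapDomain fun _ _ _ => ihu ρ
    · rw [mapDomain_add, Ctx.tail_mapDomain_liftRen]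

end NTyping

/-! ### Substitution -/

/-- `SubstTyping n a f Γ Δ c`: for each assignment `x : σ` of the context `Γ` the term `f x` has
type `σ`, and `Δ` and `c` are the sums of the contexts and of the counters of these typings. -/
inductive SubstTyping (n a : B) (f : ℕ → LTerm) : Ctx B → Ctx B → Cost → Prop
  | zero : SubstTyping n a f 0 0 0
  | cons {x : ℕ} {σ : Ty B} {Γ Δ Δ' : Ctx B} {c c' : Cost} :
      NTyping n a (f x) Δ σ c → SubstTyping n a f Γ Δ' c' →
      SubstTyping n a f (single x {σ} + Γ) (Δ + Δ') (c + c')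

namespace SubstTyping

variable {n a : B} {f : ℕ → LTerm}

theorem add {Γ Γ' Δ Δ' : Ctx B} {c c' : Cost} (h : SubstTyping n a f Γ Δ c)
    (h' : SubstTyping n a f Γ' Δ' c') : SubstTyping n a f (Γ + Γ') (Δ + Δ') (c + c') := by
  induction h with
  | zero => simpa using h'
  | cons hx _ ih => rw [add_assoc, add_assoc, add_assoc]; exact .cons hx ih

/-- Applications and closures divide their context among the premises, and the substitution must be
divided accordingly. By induction, the first assignment occurs in one of the two summands and is
cancelled there. -/
theorem split {Γ Δ : Ctx B} {c : Cost} (h : SubstTyping n a f Γ Δ c) :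
    ∀ {Γ₁ Γ₂ : Ctx B}, Γ = Γ₁ + Γ₂ → ∃ Δ₁ Δ₂ c₁ c₂, SubstTyping n a f Γ₁ Δ₁ c₁ ∧
      SubstTyping n a f Γ₂ Δ₂ c₂ ∧ Δ = Δ₁ + Δ₂ ∧ c = c₁ + c₂ := by
  induction h with
  | zero =>
    intro Γ₁ Γ₂ h
    have h₁ : Γ₁ = 0 := by
      ext1 x
      have := DFunLike.congr_fun h x
      simp only [Finsupp.coe_zero, Pi.zero_apply, Finsupp.add_apply] at this
      exact (add_eq_zero.1 this.symm).1
    subst h₁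
    rw [zero_add] at h
    subst h
    exact ⟨0, 0, 0, 0, .zero, .zero, by simp, by simp⟩
  | @cons x σ Γ Δ Δ' c c' hx _ ih =>
    intro Γ₁ Γ₂ h
    have hmem : σ ∈ Γ₁ x + Γ₂ x := by
      rw [← Finsupp.add_apply, ← h]; simp
    rcases Multiset.mem_add.1 hmem with hm | hm
    · obtain ⟨Γ₁', rfl⟩ := Ctx.exists_eq_single_add hm
      rw [add_assoc] at h
      obtain ⟨Δ₁, Δ₂, c₁, c₂, h₁, h₂, rfl, rfl⟩ := ih (add_left_cancel h)
      exact ⟨_, _, _, _, .cons hx h₁, h₂, (add_assoc _ _ _).symm, (add_assoc _ _ _).symm⟩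
    · obtain ⟨Γ₂', rfl⟩ := Ctx.exists_eq_single_add hm
      rw [add_left_comm] at h
      obtain ⟨Δ₁, Δ₂, c₁, c₂, h₁, h₂, rfl, rfl⟩ := ih (add_left_cancel h)
      exact ⟨_, _, _, _, h₁, .cons hx h₂, add_left_comm _ _ _, add_left_comm _ _ _⟩

theorem of_zero {Δ : Ctx B} {c : Cost} (h : SubstTyping n a f 0 Δ c) : Δ = 0 ∧ c = 0 := by
  generalize hΓ : (0 : Ctx B) = Γ at h
  cases h with
  | zero => exact ⟨rfl, rfl⟩
  | @cons x σ Γ => simpa using DFunLike.congr_fun hΓ x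

theorem of_single {y : ℕ} {τ : Ty B} {Δ : Ctx B} {c : Cost}
    (h : SubstTyping n a f (single y {τ}) Δ c) : NTyping n a (f y) Δ τ c := by
  generalize hΓ : (single y {τ} : Ctx B) = Γ at h
  cases h with
  | zero => simp at hΓ
  | @cons x σ Γ Δ Δ' c c' hx h =>
    have hx' := DFunLike.congr_fun hΓ x
    rw [Finsupp.add_apply, single_eq_same] at hx'
    obtain rfl : x = y := by
      by_contra hne
      rw [single_eq_of_ne hne] at hx'
      simp at hx'
    have hmem : σ ∈ (single x {τ} : Ctx B) x := by rw [hx']; simp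
    obtain rfl : σ = τ := by simpa using hmem
    obtain rfl : 0 = Γ := add_left_cancel ((add_zero _).trans hΓ)
    obtain ⟨rfl, rfl⟩ := h.of_zero
    simpa using hx

theorem of_multi {x : ℕ} {M : Multiset (Ty B)} {Δ : Ctx B} {c : Cost}
    (h : Multi (NTyping n a (f x)) M Δ c) : SubstTyping n a f (single x M) Δ c := by
  induction h with
  | zero => rw [single_zero]; exact .zero
  | cons hx _ ih =>
    rw [← Multiset.singleton_add, single_add]
    exact .cons hx ih

theorem single_var {x y : ℕ} (hf : f x = .var y) (M : Multiset (Ty B)) :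
    SubstTyping n a f (single x M) (single y M) 0 := by
  induction M using Multiset.induction with
  | empty => rw [single_zero, single_zero]; exact .zero
  | cons σ M ih =>
    rw [← Multiset.singleton_add, single_add, single_add, ← add_zero (0 : Cost)]
    exact .cons (by rw [hf]; exact ⟨rfl, rfl⟩) ih

/-- Replacing variables by variables is free. This handles the variables of `t{x\u}` other than `x`.
-/
theorem mapDomain_var {ρ : ℕ → ℕ} (hf : ∀ x, f (ρ x) = .var x) (Γ : Ctx B) :
    SubstTyping n a f (mapDomain ρ Γ) Γ 0 := by
  induction Γ using Finsupp.induction_linear with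
  | zero => rw [mapDomain_zero]; exact .zero
  | add Γ Γ' ih ih' => rw [mapDomain_add, ← add_zero (0 : Cost)]; exact ih.add ih'
  | single x M => rw [mapDomain_single]; exact single_var (hf x) M

theorem up {Γ Δ : Ctx B} {c : Cost} (h : SubstTyping n a f Γ Δ c) :
    SubstTyping n a (LTerm.up f) (mapDomain Nat.succ Γ) (mapDomain Nat.succ Δ) c := by
  induction h with
  | zero => rw [mapDomain_zero]; exact .zero
  | cons hx _ ih =>
    rw [mapDomain_add, mapDomain_add, mapDomain_single]
    exact .cons (hx.rename Nat.succ) ih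

/-- Substitutions under a binder. -/
theorem up_of_tail {Γ Δ : Ctx B} {c : Cost} (h : SubstTyping n a f Γ.tail Δ c) :
    SubstTyping n a (LTerm.up f) Γ (single 0 (Γ 0) + mapDomain Nat.succ Δ) c := by
  have := (single_var (n := n) (a := a) (f := LTerm.up f) (x := 0) (y := 0) rfl (Γ 0)).add h.up
  rwa [← Ctx.eq_single_add_mapDomain_tail, zero_add] at this

end SubstTyping

/-- The hypothesis `h` stands for the induction hypothesis of the substitution lemma on an argument,
which may be typed any number of times. -/
theorem Multi.subst {n a : B} {f : ℕ → LTerm} {t u : LTerm}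
    (h : ∀ {Γ Δ σ c d}, NTyping n a t Γ σ c → SubstTyping n a f Γ Δ d →
      NTyping n a u Δ σ (c + d))
    {M : Multiset (Ty B)} {Γ : Ctx B} {c : Cost} (H : Multi (NTyping n a t) M Γ c) :
    ∀ {Δ : Ctx B} {d : Cost}, SubstTyping n a f Γ Δ d → Multi (NTyping n a u) M Δ (c + d) := by
  induction H with
  | zero =>
    intro Δ d hs
    obtain ⟨rfl, rfl⟩ := hs.of_zero
    exact .zero
  | cons hP _ ih =>
    intro Δ d hs
    obtain ⟨Δ₁, Δ₂, d₁, d₂, h₁, h₂, rfl, rfl⟩ := hs.split rfl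
    rw [add_add_add_comm]
    exact .cons (h hP h₁) (ih h₂)

namespace NTyping

variable {n a : B}

/-- Axioms cost nothing, and each assignment `x : σ` of the context comes from one axiom. Replacing
that axiom by the corresponding typing of `f x` adds exactly the cost of the latter. -/
theorem subst {t : LTerm} : ∀ {f : ℕ → LTerm} {Γ Δ : Ctx B} {τ : Ty B} {c d : Cost},
    NTyping n a t Γ τ c → SubstTyping n a f Γ Δ d → NTyping n a (t.subst f) Δ τ (c + d) := by
  induction t with
  | var x =>
    rintro f _ Δ τ _ d ⟨rfl, rfl⟩ hs
    rw [zero_add]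
    exact hs.of_single
  | app t u iht ihu =>
    rintro f Γ Δ τ _ d (⟨rfl, c, h, rfl⟩ | ⟨Γ₁, Γ₂, M, c, c', h, hM, rfl, rfl⟩) hs
    · exact .inl ⟨rfl, _, iht h hs, by abel⟩
    · obtain ⟨Δ₁, Δ₂, d₁, d₂, h₁, h₂, rfl, rfl⟩ := hs.split rfl
      exact .inr ⟨_, _, M, c + d₁, c' + d₂, iht h h₁,
        hM.subst ihu h₂, rfl, by abel⟩
  | lam t ih =>
    rintro f _ Δ τ c d (⟨rfl, Γ', b, c', h, hT, rfl, rfl⟩ | ⟨Γ', τ', h, rfl, rfl⟩) hs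
    · exact .inl ⟨rfl, _, b, _, ih h hs.up_of_tail, by simpa using hT, by simp, by abel⟩
    · exact .inr ⟨_, τ', ih h hs.up_of_tail, by simp, by simp⟩
  | es t u iht ihu =>
    rintro f _ Δ τ _ d ⟨Γ', Γ₂, c, c', h, hM, rfl, rfl⟩ hs
    obtain ⟨Δ₁, Δ₂, d₁, d₂, h₁, h₂, rfl, rfl⟩ := hs.split rfl
    refine ⟨_, Δ₂, c + d₁, c' + d₂, iht h h₁.up_of_tail, ?_, by simp, by abel⟩
    simpa using hM.subst ihu h₂

theorem inst {t u : LTerm} {Γ Δ : Ctx B} {τ : Ty B} {c d : Cost} (h : NTyping n a t Γ τ c)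
    (hu : Multi (NTyping n a u) (Γ 0) Δ d) :
    NTyping n a (t.inst u) (Γ.tail + Δ) τ (c + d) := by
  refine h.subst ?_
  -- The bound variable is replaced by `u` at cost `d`, all other variables by variables at cost
  -- `0`.
  rw [add_comm (Ctx.tail _), ← add_zero d]
  nth_rewrite 1 [Ctx.eq_single_add_mapDomain_tail Γ]
  refine .add (.of_multi hu) ?_
  exact SubstTyping.mapDomain_var (ρ := Nat.succ) (fun _ => rfl) _

/-! ### Subject reduction -/

/-- Closures keep the type of their body, and an abstraction has type `a` or an arrow type. Hence a
`dB`-redex cannot be typed by the persistent application rule. -/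
theorem plug_lam_ne {L : List LTerm} {t : LTerm} (hna : n ≠ a) :
    ∀ {Γ : Ctx B} {c : Cost}, ¬ NTyping n a (LTerm.plug L (.lam t)) Γ (.base n) c := by
  induction L with
  | nil =>
    rintro Γ c (⟨h, -⟩ | ⟨_, _, _, _, h⟩)
    · exact hna (Ty.base_inj.1 h)
    · exact Ty.base_ne_arrow h
  | cons u L ih =>
    rintro Γ c ⟨_, _, _, _, h, -⟩
    exact ih h

/-- Firing a `dB`-redex at a distance. -/
theorem plug_es {L : List LTerm} {t : LTerm} : ∀ {u : LTerm} {Γ Δ : Ctx B}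
    {M : Multiset (Ty B)} {τ : Ty B} {c d : Cost},
    NTyping n a (LTerm.plug L (.lam t)) Γ (.arrow M τ) c → Multi (NTyping n a u) M Δ d →
    NTyping n a (LTerm.plug L (.es t (u.rename (· + L.length)))) (Γ + Δ) τ
      (c + d + (0, 1, 0)) := by
  induction L with
  | nil =>
    rintro u Γ Δ M τ c d (⟨h, -⟩ | ⟨Γ', τ', h, rfl, hτ⟩) hu
    · exact absurd h.symm Ty.base_ne_arrow
    · obtain ⟨rfl, rfl⟩ := Ty.arrow_inj.1 hτ
      have hid : u.rename (· + ([] : List LTerm).length) = u := u.rename_id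
      rw [hid]
      exact ⟨Γ', Δ, c, d, h, hu, rfl, rfl⟩
  | cons v L ih =>
    rintro u _ Δ M τ _ d ⟨Γ', Γ₂, c, c', h, hv, rfl, rfl⟩ hu
    -- Moving `u` under the outermost closure of the list context shifts it once; the rest of the
    -- context shifts it by `L.length`.
    have hr : u.rename (· + (v :: L).length) = (u.rename Nat.succ).rename (· + L.length) := by
      rw [LTerm.rename_rename]
      congr 1
      funext x
      simp only [List.length_cons, Function.comp_apply]
      omega
    rw [hr]
    refine ⟨_, Γ₂, _, c', ih h (hu.mapDomain fun _ _ _ => .rename Nat.succ), ?_, ?_, ?_⟩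
    · simpa using hv
    · simp only [Ctx.tail_add, Ctx.tail_mapDomain_succ]; abel
    · abel

end NTyping

/-- The counters of a single step. -/
def StepKind.cost : StepKind → Cost
  | .m => (1, 0, 0)
  | .e => (0, 1, 0)

namespace NTyping

variable {n a : B}

/-- The equality is exact because the contexts of call-by-name reduction never enter an argument:
the redex is typed exactly once, whereas an argument may be typed any number of times. -/
theorem nStep {k : StepKind} {t t' : LTerm} (hna : n ≠ a) (hs : LTerm.NStep k t t') :
    ∀ {Γ : Ctx B} {τ : Ty B} {c : Cost}, NTyping n a t Γ τ c →
      ∃ d, NTyping n a t' Γ τ d ∧ c = d + k.cost := by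
  induction hs with
  | dB L t u =>
    rintro Γ τ c (⟨rfl, d, h, rfl⟩ | ⟨Γ', Δ, M, d, d', h, hM, rfl, rfl⟩)
    · exact absurd h (plug_lam_ne hna)
    · refine ⟨_, plug_es h hM, ?_⟩
      -- The cost `(1, 1, 0)` of the application is `(0, 1, 0)` for the new closure plus `(1, 0, 0)`
      -- for the step.
      rw [add_assoc (d + d')]
      rfl
  | sn t u =>
    rintro Γ τ c ⟨Γ', Δ, d, d', h, hM, rfl, rfl⟩
    exact ⟨_, h.inst hM, rfl⟩
  | app u _ ih =>
    rintro Γ τ c (⟨rfl, d, h, rfl⟩ | ⟨Γ', Δ, M, d, d', h, hM, rfl, rfl⟩)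
    · obtain ⟨d, h', rfl⟩ := ih h
      exact ⟨_, .inl ⟨rfl, d, h', rfl⟩, by abel⟩
    · obtain ⟨d, h', rfl⟩ := ih h
      exact ⟨_, .inr ⟨Γ', Δ, M, d, d', h', hM, rfl, rfl⟩, by abel⟩
  | lam _ ih =>
    rintro Γ τ c (⟨rfl, Γ', b, d, h, hT, rfl, rfl⟩ | ⟨Γ', τ', h, rfl, rfl⟩)
    · obtain ⟨d, h', rfl⟩ := ih h
      exact ⟨_, .inl ⟨rfl, Γ', b, d, h', hT, rfl, rfl⟩, by abel⟩
    · obtain ⟨d, h', rfl⟩ := ih h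
      exact ⟨d, .inr ⟨Γ', τ', h', rfl, rfl⟩, rfl⟩
  | es u _ ih =>
    rintro Γ τ c ⟨Γ', Δ, d, d', h, hM, rfl, rfl⟩
    obtain ⟨d, h', rfl⟩ := ih h
    exact ⟨_, ⟨Γ', Δ, d, d', h', hM, rfl, rfl⟩, by abel⟩

/-! ### Soundness of tight typings -/

/-- Tightness spreads from the head variable: its type is tight, hence not an arrow. Each
application is then persistent, leaves its argument untyped, and adds one to the size counter. -/
theorem of_isNe {t : LTerm} (ht : t.IsNe) : ∀ {Γ : Ctx B} {τ : Ty B} {c : Cost},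
    Γ.Tight → NTyping n a t Γ τ c → τ.Tight ∧ c = (0, 0, t.nsize) := by
  induction ht with
  | var x =>
    rintro _ τ c hΓ ⟨rfl, rfl⟩
    exact ⟨hΓ x τ (by simp), rfl⟩
  | app u _ ih =>
    rintro Γ τ c hΓ (⟨rfl, d, h, rfl⟩ | ⟨Γ', Δ, M, d, d', h, hM, rfl, rfl⟩)
    · obtain ⟨hτ, rfl⟩ := ih hΓ h
      exact ⟨hτ, rfl⟩
    · have hΓ' : Γ'.Tight := fun x σ hσ => hΓ x σ (Multiset.mem_add.2 (.inl hσ))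
      obtain ⟨⟨b, hb⟩, -⟩ := ih hΓ' h
      exact absurd hb.symm Ty.base_ne_arrow

theorem of_isNo {t : LTerm} (ht : t.IsNo) : ∀ {Γ : Ctx B} {τ : Ty B} {c : Cost},
    Γ.Tight → τ.Tight → NTyping n a t Γ τ c → c = (0, 0, t.nsize) := by
  induction ht with
  | lam _ ih =>
    rintro Γ τ c hΓ ⟨b, hb⟩ (⟨rfl, Γ', b', d, h, hT, rfl, rfl⟩ | ⟨Γ', τ', h, rfl, rfl⟩)
    -- The side condition on the bound variable makes the context of the body tight again.
    · obtain rfl := ih (.of_tail hT hΓ) ⟨b', rfl⟩ h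
      rfl
    · exact absurd hb.symm Ty.base_ne_arrow
  | ne ht => intro Γ τ c hΓ _ h; exact (of_isNe ht hΓ h).2

/-- Any redex may be chosen, since every step lowers `m + e` by one. With `m + e = 0` no step is
possible; with `m + e > 0` the term is not normal. -/
theorem exists_countedRed (hna : n ≠ a) {Γ : Ctx B} {τ : Ty B} (hΓ : Γ.Tight) (hτ : τ.Tight) :
    ∀ (N : ℕ) {t : LTerm} {m e s : ℕ}, m + e = N → NTyping n a t Γ τ (m, e, s) →
      ∃ p : LTerm, p.IsNo ∧ CountedRed LTerm.NStep m e t p ∧ p.nsize = s := by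
  intro N
  induction N with
  | zero =>
    intro t m e s hN h
    obtain ⟨rfl, rfl⟩ : m = 0 ∧ e = 0 := by omega
    rcases t.isNo_or_nStep with ht | ⟨k, t', hs⟩
    · exact ⟨t, ht, .refl t, (Prod.ext_iff.1 (Prod.ext_iff.1 (of_isNo ht hΓ hτ h)).2).2.symm⟩
    · obtain ⟨⟨m, e, s⟩, -, hc⟩ := h.nStep hna hs
      cases k <;> simp [StepKind.cost] at hc
  | succ N ih =>
    intro t m e s hN h
    rcases t.isNo_or_nStep with ht | ⟨k, t', hs⟩
    · have := of_isNo ht hΓ hτ h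
      simp only [Prod.mk.injEq] at this
      omega
    · obtain ⟨⟨m', e', s'⟩, h', hc⟩ := h.nStep hna hs
      cases k <;> simp only [StepKind.cost, Prod.mk_add_mk, Prod.mk.injEq, add_zero] at hc <;>
        obtain ⟨rfl, rfl, rfl⟩ := hc <;>
        obtain ⟨p, hp, hr, hsz⟩ := ih (by omega) h'
      · exact ⟨p, hp, .mStep hs hr, hsz⟩
      · exact ⟨p, hp, .eStep hs hr, hsz⟩

end NTyping

/-! ### From derivations to typings -/

theorem NDer.nTyping {Γ : Ctx NBase} {t : LTerm} {σ : Ty NBase} {m e s : ℕ}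
    (Φ : NDer Γ t σ m e s) : NTyping NBase.n NBase.a t Γ σ (m, e, s) := by
  induction Φ with
  | appP u _ ih => exact .inl ⟨rfl, _, ih, rfl⟩
  | absP _ hT ih => exact .inl ⟨rfl, _, _, _, ih, hT, rfl, rfl⟩
  | varC x σ => exact ⟨rfl, rfl⟩
  | absC _ ih => exact .inr ⟨_, _, ih, rfl, rfl⟩
  | appC _ _ ih ih' =>
    refine .inr ⟨_, _, _, _, _, ih, .of_fin ih', rfl, ?_⟩
    ext <;> simp [Prod.fst_sum, Prod.snd_sum] <;> omega
  | esC _ hb _ ih ih' =>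
    refine ⟨_, _, _, _, ih, by rw [hb]; exact .of_fin ih', rfl, ?_⟩
    ext <;> simp [Prod.fst_sum, Prod.snd_sum, add_right_comm, add_comm 1]

theorem BDer.bang_base {Γ : Ctx BBase} {t : BTerm} {b : BBase} {m e s : ℕ}
    (Φ : BDer Γ (.bang t) (.base b) m e s) : b = .vl ∧ Γ = 0 ∧ m = 0 ∧ e = 0 ∧ s = 0 := by
  generalize hσ : Ty.base b = σ at Φ
  cases Φ with
  | bgP => exact ⟨Ty.base_inj.1 hσ, rfl, rfl, rfl, rfl⟩
  | bgC => exact absurd hσ Ty.base_ne_multi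

/-- The e-unit charged by the bang rule is the one that system N charges at the application or
closure holding the argument. The predicate `P` receives the induction hypothesis on that argument.
-/
theorem BDer.bang_multi {P : Ctx BBase → Ty BBase → Cost → Prop} {Γ : Ctx BBase} {t : BTerm}
    {M : Multiset (Ty BBase)} {m e s : ℕ} (Φ : BDer Γ (.bang t) (.multi M) m e s)
    (hP : ∀ {Γ σ m e s}, BDer Γ t σ m e s → P Γ σ (m, e, s)) :
    ∃ d, Multi P M Γ d ∧ (m, e, s) = d + (0, 1, 0) := by
  generalize hσ : Ty.multi M = σ at Φ
  cases Φ with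
  | bgP => exact absurd hσ.symm Ty.base_ne_multi
  | bgC _ Φ =>
    obtain rfl := Ty.multi_inj.1 hσ
    refine ⟨_, .of_fin fun i => hP (Φ i), ?_⟩
    ext <;> simp [Prod.fst_sum, Prod.snd_sum, add_comm 1]

/-- The rules of B match those of N because all arguments in `cbn t` are bangs: `vl` corresponds to
an untyped argument, a multitype to a typed one. -/
theorem BDer.nTyping {t : LTerm} : ∀ {Γ : Ctx BBase} {σ : Ty BBase} {m e s : ℕ},
    BDer Γ (cbn t) σ m e s → NTyping BBase.n BBase.a t Γ σ (m, e, s) := by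
  induction t with
  | var x =>
    intro Γ σ m e s Φ
    cases Φ
    exact ⟨rfl, rfl⟩
  | app t u iht ihu =>
    intro Γ σ m e s Φ
    cases Φ with
    | appP Φ Ψ _ =>
      obtain ⟨-, rfl, rfl, rfl, rfl⟩ := Ψ.bang_base
      exact .inl ⟨rfl, _, by simpa using iht Φ, rfl⟩
    | appC Φ Ψ =>
      obtain ⟨⟨m', e', s'⟩, h, hc⟩ := Ψ.bang_multi ihu
      simp only [Prod.mk_add_mk, Prod.mk.injEq, add_zero] at hc
      obtain ⟨rfl, rfl, rfl⟩ := hc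
      exact .inr ⟨_, _, _, _, _, iht Φ, h, rfl, rfl⟩
    -- The argument would be a bang of type `n`, but the only base type of a bang is `vl`.
    | apptC Φ Ψ _ => cases Ψ.bang_base.1
  | lam t ih =>
    intro Γ σ m e s Φ
    cases Φ with
    | absP Φ hT => exact .inl ⟨rfl, _, _, _, ih Φ, hT, rfl, rfl⟩
    | absC Φ => exact .inr ⟨_, _, ih Φ, rfl, rfl⟩
  | es t u iht ihu =>
    intro Γ σ m e s Φ
    cases Φ with
    | esP Φ Ψ _ => cases Ψ.bang_base.1
    | esC Φ Ψ =>
      obtain ⟨⟨m', e', s'⟩, h, hc⟩ := Ψ.bang_multi ihu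
      simp only [Prod.mk_add_mk, Prod.mk.injEq, add_zero] at hc
      obtain ⟨rfl, rfl, rfl⟩ := hc
      exact ⟨_, _, _, _, iht Φ, h, rfl, rfl⟩

/-! ### Simulation -/

theorem cbn_rename (t : LTerm) : ∀ ρ, cbn (t.rename ρ) = (cbn t).rename ρ := by
  induction t <;> intro ρ <;> simp_all [cbn, LTerm.rename, BTerm.rename]

theorem cbn_up (f : ℕ → LTerm) : (fun i => cbn (LTerm.up f i)) = BTerm.up (fun i => cbn (f i)) := by
  funext i
  cases i with
  | zero => rfl
  | succ i => exact cbn_rename _ _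

theorem cbn_subst (t : LTerm) : ∀ f, cbn (t.subst f) = (cbn t).subst (fun i => cbn (f i)) := by
  induction t <;> intro f <;> simp_all [cbn, LTerm.subst, BTerm.subst, cbn_up]

theorem cbn_inst (t u : LTerm) : cbn (t.inst u) = (cbn t).inst (cbn u) := by
  rw [LTerm.inst, BTerm.inst, cbn_subst]
  congr 1
  funext i
  cases i <;> rfl

theorem cbn_plug (L : List LTerm) (t : LTerm) :
    cbn (LTerm.plug L t) = BTerm.plug (L.map fun u => .bang (cbn u)) (cbn t) := by
  induction L with
  | nil => rfl
  | cons u L ih => simp only [LTerm.plug, cbn, List.map_cons, BTerm.plug, ih]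

theorem BTerm.rename_id (t : BTerm) : t.rename id = t := by
  induction t <;> simp_all [BTerm.rename, LTerm.liftRen_id]

theorem LTerm.NStep.cbn {k : StepKind} {t t' : LTerm} (h : LTerm.NStep k t t') :
    BTerm.FStep k (cbn t) (cbn t') := by
  induction h with
  | dB L t u =>
    have := BTerm.FStep.dB (L.map fun u => .bang (TightTyping.cbn u)) (TightTyping.cbn t)
      (.bang (TightTyping.cbn u))
    simpa only [TightTyping.cbn, cbn_plug, cbn_rename, List.length_map, BTerm.rename] using this
  | sn t u =>
    -- A translated closure has a bang directly as its argument. The list context is empty and the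
    -- shift is the identity.
    have h : (TightTyping.cbn t).rename (liftRen (· + ([] : List BTerm).length)) =
        TightTyping.cbn t := by
      have : liftRen (· + ([] : List BTerm).length) = id := LTerm.liftRen_id
      rw [this, BTerm.rename_id]
    have := BTerm.FStep.sBang [] (TightTyping.cbn t) (TightTyping.cbn u)
    rw [h] at this
    rw [cbn_inst]
    exact this
  | app u _ ih => exact .appL _ ih
  | lam _ ih => exact .lam ih
  | es u _ ih => exact .esL _ ih

theorem CountedRed.cbn {m e : ℕ} {t u : LTerm} (h : CountedRed LTerm.NStep m e t u) :
    CountedRed BTerm.FStep m e (cbn t) (cbn u) := by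
  induction h with
  | refl t => exact .refl _
  | mStep h _ ih => exact .mStep h.cbn ih
  | eStep h _ ih => exact .eStep h.cbn ih

theorem fsize_cbn (t : LTerm) : (cbn t).fsize = t.nsize := by
  induction t <;> simp [cbn, BTerm.fsize, LTerm.nsize, *, add_comm]

/-! ### Translated normal forms -/

namespace LTerm

theorem IsNe.isNeScf {t : LTerm} (h : t.IsNe) : (cbn t).IsNeScf := by
  induction h with
  | var x => exact .var x
  | app u _ ih => exact .app ih (.bang _)

theorem IsNo.isNoScf {t : LTerm} (h : t.IsNo) : (cbn t).IsNoScf := by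
  induction h with
  | lam _ ih => exact .nb (.lam ih)
  | ne h => exact .na (.ne h.isNeScf)

theorem IsNe.plug_lam_ne {t : LTerm} (h : t.IsNe) (L : List BTerm) (u : BTerm) :
    BTerm.plug L (.lam u) ≠ cbn t := by
  cases h <;> cases L <;> simp [BTerm.plug, cbn]

theorem IsNe.plug_bang_ne {t : LTerm} (h : t.IsNe) (L : List BTerm) (u : BTerm) :
    BTerm.plug L (.bang u) ≠ cbn t := by
  cases h <;> cases L <;> simp [BTerm.plug, cbn]

/-- No head of a neutral term is an abstraction under closures, and surface reduction does not enter
the bangs that form the arguments. -/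
theorem IsNe.fNormal {t : LTerm} (h : t.IsNe) : (cbn t).FNormal := by
  induction h with
  | var x => intro k t' hs; cases hs
  | app u h ih =>
    intro k t' hs
    rw [cbn] at hs
    generalize hv : cbn _ = v at hs ih
    cases hs with
    | dB L => exact h.plug_lam_ne _ _ hv.symm
    | appL _ hs => exact ih _ _ hs
    | appR _ hs => cases hs

theorem IsNo.fNormal {t : LTerm} (h : t.IsNo) : (cbn t).FNormal := by
  induction h with
  | lam _ ih =>
    intro k t' hs
    cases hs with
    | lam hs => exact ih _ _ hs
  | ne h => exact h.fNormal

theorem IsNe.not_hasSurfaceClash {t : LTerm} (h : t.IsNe) : ¬ (cbn t).HasSurfaceClash := by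
  induction h with
  | var x => intro hc; cases hc with | clash hc => cases hc
  | @app t u h ih =>
    intro hc
    rw [cbn] at hc
    generalize hv : cbn t = v at hc ih
    generalize hw : BTerm.bang (cbn u) = w at hc
    cases hc with
    | clash hc =>
      cases hc with
      | appBang L => exact h.plug_bang_ne _ _ hv.symm
      | appLam L => cases L <;> cases hw
    | appL _ hc => exact ih hc
    | appR _ hc => subst hw; cases hc with | clash hc => cases hc

theorem IsNo.not_hasSurfaceClash {t : LTerm} (h : t.IsNo) : ¬ (cbn t).HasSurfaceClash := by
  induction h with
  | lam _ ih =>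
    intro hc
    cases hc with
    | clash hc => cases hc
    | lam hc => exact ih hc
  | ne h => exact h.not_hasSurfaceClash

/-- The translated term is normal, so it is its own only reduct, and only its own shape has to be
inspected. -/
theorem IsNo.surfaceClashFree {t : LTerm} (h : t.IsNo) : (cbn t).SurfaceClashFree := by
  intro m e t' hr
  cases hr with
  | refl => exact h.not_hasSurfaceClash
  | mStep hs => exact absurd hs (h.fNormal _ _)
  | eStep hs => exact absurd hs (h.fNormal _ _)

end LTerm

end TightTyping

end

-- The two directions of the corollary

theorem mainTheorem7 :
    (∀ (Γ : Ctx NBase) (t : LTerm) (σ : Ty NBase) (m e s : ℕ) (Φ : NDer Γ t σ m e s),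
      Φ.Tight →
        ∃ p : BTerm, p.IsNoScf ∧ p.FNormal ∧ p.SurfaceClashFree ∧
          CountedRed BTerm.FStep m e (cbn t) p ∧ p.fsize = s) ∧
    (∀ (Γ : Ctx NBase) (t : LTerm) (σ : Ty NBase) (m e s : ℕ)
        (Φ' : BDer (cbnCtx Γ) (cbn t) (cbnTy σ) m e s),
      Φ'.Tight → Φ'.CbnRelevant →
        ∃ p : LTerm, p.IsNo ∧ CountedRed LTerm.NStep m e t p ∧ p.nsize = s) := by
  constructor
  · intro Γ t σ m e s Φ hΦ
    obtain ⟨p, hp, hr, hs⟩ :=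
      Φ.nTyping.exists_countedRed (by simp) hΦ.1 hΦ.2 _ rfl
    exact ⟨cbn p, hp.isNoScf, hp.fNormal, hp.surfaceClashFree, hr.cbn, (fsize_cbn p).trans hs⟩
  · intro Γ t σ m e s Φ hΦ _
    -- Soundness is applied with base types `BBase`; its conclusion already concerns the
    -- call-by-name term `t`.
    exact Φ.nTyping.exists_countedRed (by simp) hΦ.1 hΦ.2 _ rfl
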